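/- Let $(R,\mathfrak m)$ be a complete Noetherian local ring with residue field $k$, let $E$ be an injective hull of $k$, and write $M^\vee=\operatorname{Hom}_R(M,E)$; for a submodule $N\subseteq M$ view $(M/N)^\vee$ as the submodule of $M^\vee$ of maps that vanish on $N$. An interior operation $\mathrm i$ on Artinian $R$-modules assigns to each Artinian module $M$ a submodule $\mathrm i(M)\subseteq M$, compatibly with isomorphisms, such that $\mathrm i(L)\subseteq \mathrm i(M)$ for $L\subseteq M$ and $\mathrm i(\mathrm i(M))=\mathrm i(M)$. It is Nakayama if for all Artinian modules $A\subseteq B$, $\mathrm i(A:_B\mathfrak m)\subseteq A$ implies $\mathrm i(A)=\mathrm i(B)$. A residual closure operation $\mathrm{cl}$ on finitely generated $R$-modules assigns to each submodule $L$ of a finitely generated module $M$ a submodule $L^{\mathrm{cl}}_M$ with $L\subseteq L^{\mathrm{cl}}_M\subseteq M$, such that $(L^{\mathrm{cl}}_M)^{\mathrm{cl}}_M=L^{\mathrm{cl}}_M$, $L^{\mathrm{cl}}_M\subseteq N^{\mathrm{cl}}_M$ for $L\subseteq N\subseteq M$, and $(\ker q)^{\mathrm{cl}}_M=q^{-1}(0^{\mathrm{cl}}_P)$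 for every surjection $q:M\to P$ of finitely generated modules. It is dual to $\mathrm i$ if $0^{\mathrm{cl}}_M=\bigl(M^\vee/\mathrm i(M^\vee)\bigr)^\vee$, taken as a submodule of $M$ along the evaluation map $M\to M^{\vee\vee}$, for every finitely generated $M$. Let $\mathrm i$ be a Nakayama interior on Artinian $R$-modules. Then a residual closure operation $\mathrm{cl}$ on finitely generated $R$-modules dual to $\mathrm i$ exists. Moreover, for any such $\mathrm{cl}$ and all Artinian $R$-modules $A\subseteq B$, the evaluation map $B\to B^{\vee\vee}$ is an isomorphism, and under this identification \[ \bigl(B^\vee/\mathrm{cl}\text{-core}_{B^\vee}((B/A)^\vee)\bigr)^\vee=\mathrm i\text{-hull}^B(A). \] Here $\mathrm i\text{-hull}^B(A)$ is the sum of all $\mathrm i$-expansions of $A$ in $B$, i.e. of all modules $C$ with $A\subseteq C\subseteq B$ and $\mathrm i(C)=\mathrm i(A)$, and $\mathrm{cl}\text{-core}_M(N)$ is the intersection of all $\mathrm{cl}$-reductions of $N$ in $M$, i.e. of all submodules $L\subseteq N$ with $L^{\mathrm{cl}}_M=N^{\mathrm{cl}}_M$. -/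

import Mathlib

universe u

namespace CoreHull

/-- `E` is an injective hull of the `R`-module `K`: `E` is injective and an essential extension
of a copy of `K`. -/
def IsInjectiveHull (R : Type u) [CommRing R] (K : Type u) [AddCommGroup K] [Module R K]
    (E : Type u) [AddCommGroup E] [Module R E] : Prop :=
  Module.Injective R E ∧
    ∃ ι : K →ₗ[R] E, Function.Injective ι ∧
      ∀ N : Submodule R E, N ≠ ⊥ → LinearMap.range ι ⊓ N ≠ ⊥

section Matlis

variable {R : Type u} [CommRing R] (E : Type u) [AddCommGroup E] [Module R E]

/-- The dual `M^∨ = Hom_R(M, E)` (the Matlis dual when `E` is the injective hull of the residue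
field of a local ring). -/
abbrev MatlisDual (M : Type u) [AddCommGroup M] [Module R M] : Type u := M →ₗ[R] E

/-- The evaluation map `M → M^∨∨`. -/
def biduality (M : Type u) [AddCommGroup M] [Module R M] :
    M →ₗ[R] MatlisDual (R := R) E (MatlisDual (R := R) E M) :=
  LinearMap.applyₗ

/-- `(M/N)^∨` viewed as a submodule of `M^∨`, through the dual of the projection `M → M/N`. -/
def quotientDual {M : Type u} [AddCommGroup M] [Module R M] (N : Submodule R M) :
    Submodule R (MatlisDual (R := R) E M) :=
  LinearMap.range (LinearMap.lcomp R E N.mkQ)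

end Matlis

/-- An assignment `M ↦ α(M) ⊆ M`. It is defined on all modules for convenience; the laws below are
imposed only on the class of modules on which the operation is considered, and the values outside
that class play no role. -/
abbrev Selector (R : Type u) [CommRing R] : Type (u + 1) :=
  ∀ (M : Type u) [AddCommGroup M] [Module R M], Submodule R M

/-- An assignment `(L ⊆ M) ↦ L^cl_M ⊆ M`, with the same convention about its domain. -/
abbrev ClosureAssignment (R : Type u) [CommRing R] : Type (u + 1) :=
  ∀ (M : Type u) [AddCommGroup M] [Module R M], Submodule R M → Submodule R M

section Operations

variable {R : Type u} [CommRing R]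

/-- `i` is an interior operation on the class of Artinian `R`-modules: a submodule selector
(compatible with isomorphisms) that is order-preserving and idempotent. -/
structure IsInteriorOnArtinian (i : Selector R) : Prop where
  map_equiv : ∀ (M N : Type u) [AddCommGroup M] [Module R M] [AddCommGroup N] [Module R N]
    [IsArtinian R M] [IsArtinian R N] (e : M ≃ₗ[R] N),
    (i M).map (e : M →ₗ[R] N) = i N
  mono : ∀ (M : Type u) [AddCommGroup M] [Module R M] [IsArtinian R M] (L : Submodule R M),
    (i L).map L.subtype ≤ i M
  idem : ∀ (M : Type u) [AddCommGroup M] [Module R M] [IsArtinian R M],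
    (i (i M)).map (i M).subtype = i M

/-- `(A :_B I) = {b ∈ B | I b ⊆ A}`. -/
def colonIn {B : Type u} [AddCommGroup B] [Module R B] (A : Submodule R B) (I : Ideal R) :
    Submodule R B where
  carrier := {b | ∀ r ∈ I, r • b ∈ A}
  zero_mem' := fun r _ => by simp
  add_mem' := fun hx hy r hr => by
    rw [smul_add]
    exact A.add_mem (hx r hr) (hy r hr)
  smul_mem' := fun c x hx r hr => by
    rw [smul_comm]
    exact A.smul_mem c (hx r hr)

/-- `i` is a Nakayama interior on Artinian `R`-modules: it is an interior operation and, for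
Artinian modules `A ⊆ B`, `i(A :_B 𝔪) ⊆ A` implies `i(A) = i(B)`. -/
structure IsNakayamaInterior [IsLocalRing R] (i : Selector R) : Prop
    extends IsInteriorOnArtinian i where
  nakayama : ∀ (B : Type u) [AddCommGroup B] [Module R B] [IsArtinian R B] (A : Submodule R B),
    (i (colonIn A (IsLocalRing.maximalIdeal R))).map
        (colonIn A (IsLocalRing.maximalIdeal R)).subtype ≤ A →
      (i A).map A.subtype = i B

/-- `cl` is a residual closure operation on the class of finitely generated `R`-modules. -/
structure IsResidualClosureOnFinite (cl : ClosureAssignment R) : Prop where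
  le_cl : ∀ (M : Type u) [AddCommGroup M] [Module R M] [Module.Finite R M] (L : Submodule R M),
    L ≤ cl M L
  idem : ∀ (M : Type u) [AddCommGroup M] [Module R M] [Module.Finite R M] (L : Submodule R M),
    cl M (cl M L) = cl M L
  mono : ∀ (M : Type u) [AddCommGroup M] [Module R M] [Module.Finite R M] (L N : Submodule R M),
    L ≤ N → cl M L ≤ cl M N
  residual : ∀ (M P : Type u) [AddCommGroup M] [Module R M] [AddCommGroup P] [Module R P]
    [Module.Finite R M] [Module.Finite R P] (q : M →ₗ[R] P), Function.Surjective q →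
    cl M (LinearMap.ker q) = (cl P ⊥).comap q

/-- The dual selector `α^⌣(M) = (M^∨ / α(M^∨))^∨`, a submodule of `M^∨∨`, pulled back to `M` along
the evaluation map `M → M^∨∨`. -/
def dualSelector (E : Type u) [AddCommGroup E] [Module R E] (α : Selector R) : Selector R :=
  fun M _ _ => (quotientDual (R := R) E (α (MatlisDual (R := R) E M))).comap (biduality E M)

/-- `cl` is the closure operation dual to `i`: the residual closure operation on finitely generated
modules with `0^cl_M = i^⌣(M)` for every finitely generated `M`. -/
structure IsDualClosure (E : Type u) [AddCommGroup E] [Module R E] (i : Selector R)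
    (cl : ClosureAssignment R) : Prop extends IsResidualClosureOnFinite cl where
  cl_bot : ∀ (M : Type u) [AddCommGroup M] [Module R M] [Module.Finite R M],
    cl M ⊥ = dualSelector E i M

/-- `C` is an `i`-expansion of `A` in `B`: `A ⊆ C ⊆ B` and `i(A) = i(C)`. -/
def IsExpansion (i : Selector R) {B : Type u} [AddCommGroup B] [Module R B]
    (A C : Submodule R B) : Prop :=
  A ≤ C ∧ (i A).map A.subtype = (i C).map C.subtype

/-- The `i`-hull of `A` in `B`: the sum of all `i`-expansions of `A` in `B`. -/
def hull (i : Selector R) {B : Type u} [AddCommGroup B] [Module R B]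
    (A : Submodule R B) : Submodule R B :=
  sSup {C | IsExpansion i A C}

/-- `L` is a `cl`-reduction of `N` in `M`: `L ⊆ N ⊆ M` and `L^cl_M = N^cl_M`. -/
def IsReduction (cl : ClosureAssignment R) {M : Type u} [AddCommGroup M] [Module R M]
    (N L : Submodule R M) : Prop :=
  L ≤ N ∧ cl M L = cl M N

/-- The `cl`-core of `N` in `M`: the intersection of all `cl`-reductions of `N` in `M`. -/
def core (cl : ClosureAssignment R) {M : Type u} [AddCommGroup M] [Module R M]
    (N : Submodule R M) : Submodule R M :=
  sInf {L | IsReduction cl N L}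

end Operations

end CoreHull

/-! Matlis duality turns the statement into bookkeeping. For Artinian `B`, the dual `B^∨` is
finitely generated, evaluation on `B` is bijective, and `quotientDual` and `annihilated` are
mutually inverse, order-reversing bijections between submodules of `B` and of `B^∨`. Residuality
forces the closure of `L` in `M` to be the preimage of the closure of zero in `M/L`, hence the
annihilator of the interior of `(M/L)^∨` inside `M^∨` (`dualClosure_ker`). This formula proves
existence, determines `cl` on finitely generated modules (`IsDualClosure.eq_dualClosure`), and says
that closures dualize to interiors. So reductions of `(B/A)^∨` are exactly the duals of expansions
of `A` (`isReduction_quotientDual_iff`), and the intersection of the former is dual to the sum of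
the latter (`core_quotientDual`). -/

namespace CoreHull

/-! ### Duality into a module that is injective or separates points -/

section Duality

variable {R : Type u} [CommRing R] {E : Type u} [AddCommGroup E] [Module R E]
  {M : Type u} [AddCommGroup M] [Module R M]

@[simp]
theorem biduality_apply (x : M) (f : MatlisDual (R := R) E M) : biduality E M x f = f x := rfl

theorem mem_quotientDual {N : Submodule R M} {f : MatlisDual (R := R) E M} :
    f ∈ quotientDual E N ↔ ∀ x ∈ N, f x = 0 := by
  constructor
  · rintro ⟨g, rfl⟩ x hx
    simp [(Submodule.Quotient.mk_eq_zero N).2 hx]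
  · intro h
    exact ⟨N.liftQ f h, rfl⟩

theorem quotientDual_anti {N N' : Submodule R M} (h : N ≤ N') :
    quotientDual E N' ≤ quotientDual E N := fun _ hf =>
  mem_quotientDual.2 fun x hx => mem_quotientDual.1 hf x (h hx)

/-- The submodule of `M` annihilated by a submodule `D` of `M^∨`. -/
def annihilated (D : Submodule R (MatlisDual (R := R) E M)) : Submodule R M :=
  (quotientDual E D).comap (biduality E M)

theorem mem_annihilated {D : Submodule R (MatlisDual (R := R) E M)} {x : M} :
    x ∈ annihilated D ↔ ∀ f ∈ D, f x = 0 :=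
  mem_quotientDual

theorem annihilated_anti {D D' : Submodule R (MatlisDual (R := R) E M)} (h : D ≤ D') :
    annihilated D' ≤ annihilated D := fun _ hx =>
  mem_annihilated.2 fun f hf => mem_annihilated.1 hx f (h hf)

/-- `E` cogenerates: homomorphisms to `E` separate points. -/
def SeparatesPoints (R : Type u) [CommRing R] (E : Type u) [AddCommGroup E] [Module R E] : Prop :=
  ∀ (M : Type u) [AddCommGroup M] [Module R M] (x : M), x ≠ 0 → ∃ f : M →ₗ[R] E, f x ≠ 0

theorem SeparatesPoints.biduality_injective (hs : SeparatesPoints R E) :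
    Function.Injective (biduality (R := R) E M) := by
  rw [injective_iff_map_eq_zero]
  intro x hx
  by_contra h
  obtain ⟨f, hf⟩ := hs M x h
  exact hf (by rw [← biduality_apply, hx, LinearMap.zero_apply])

theorem SeparatesPoints.exists_mem_quotientDual (hs : SeparatesPoints R E) {N : Submodule R M}
    {x : M} (hx : x ∉ N) : ∃ f ∈ quotientDual E N, f x ≠ 0 := by
  obtain ⟨f, hf⟩ := hs (M ⧸ N) (N.mkQ x) (by simpa using hx)
  exact ⟨f ∘ₗ N.mkQ, ⟨f, rfl⟩, hf⟩

theorem SeparatesPoints.annihilated_quotientDual (hs : SeparatesPoints R E) (N : Submodule R M) :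
    annihilated (quotientDual E N) = N := by
  refine le_antisymm (fun x hx => ?_) fun x hx =>
    mem_annihilated.2 fun f hf => mem_quotientDual.1 hf x hx
  by_contra h
  obtain ⟨f, hf, hfx⟩ := hs.exists_mem_quotientDual h
  exact hfx (mem_annihilated.1 hx f hf)

/-- A functional outside `D` is detected by an element of `M^∨∨` vanishing on `D`; surjectivity of
evaluation makes that element a point of `M` annihilated by `D`. -/
theorem SeparatesPoints.quotientDual_annihilated (hs : SeparatesPoints R E)
    (hM : Function.Surjective (biduality (R := R) E M))
    (D : Submodule R (MatlisDual (R := R) E M)) : quotientDual E (annihilated D) = D := by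
  refine le_antisymm (fun f hf => ?_) fun f hf =>
    mem_quotientDual.2 fun x hx => mem_annihilated.1 hx f hf
  by_contra h
  obtain ⟨φ, hφ, hφf⟩ := hs.exists_mem_quotientDual h
  obtain ⟨x, rfl⟩ := hM φ
  exact hφf (mem_quotientDual.1 hf x hφ)

theorem SeparatesPoints.quotientDual_quotientDual (hs : SeparatesPoints R E)
    (hM : Function.Surjective (biduality (R := R) E M)) (A : Submodule R M) :
    quotientDual E (quotientDual E A) = A.map (biduality E M) := by
  rw [← Submodule.map_comap_eq_of_surjective hM (quotientDual E (quotientDual E A))]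
  exact congrArg _ (hs.annihilated_quotientDual A)

theorem SeparatesPoints.isArtinian_dual (hs : SeparatesPoints R E) [IsNoetherian R M]
    (hM : Function.Surjective (biduality (R := R) E M)) :
    IsArtinian R (MatlisDual (R := R) E M) := by
  have hinj : Function.Injective
      (annihilated : Submodule R (MatlisDual (R := R) E M) → Submodule R M) :=
    Function.LeftInverse.injective (hs.quotientDual_annihilated hM)
  have hanti : StrictAnti
      (annihilated : Submodule R (MatlisDual (R := R) E M) → Submodule R M) :=
    Antitone.strictAnti_of_injective (fun _ _ => annihilated_anti) hinj
  exact hanti.wellFoundedLT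

theorem biduality_surjective_of_surjective [hE : Module.Injective R E]
    {P : Type u} [AddCommGroup P] [Module R P] (q : M →ₗ[R] P) (hq : Function.Surjective q)
    (hM : Function.Surjective (biduality (R := R) E M)) :
    Function.Surjective (biduality (R := R) E P) := by
  intro F
  have hinj : Function.Injective (LinearMap.lcomp R E q) := fun f g h => by
    ext x
    obtain ⟨y, rfl⟩ := hq x
    exact LinearMap.congr_fun h y
  obtain ⟨G, hG⟩ := hE.out (LinearMap.lcomp R E q) hinj F
  obtain ⟨x, rfl⟩ := hM G
  exact ⟨q x, by ext f; simpa using hG f⟩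

/-- A diagram chase: subtracting evaluation at a suitable `x` makes `F` vanish on `(M/N)^∨`, so the
difference factors through restriction `M^∨ → N^∨`, which is onto by injectivity of `E`. -/
theorem biduality_surjective_of_submodule_of_quotient [hE : Module.Injective R E]
    (N : Submodule R M) (hN : Function.Surjective (biduality (R := R) E N))
    (hQ : Function.Surjective (biduality (R := R) E (M ⧸ N))) :
    Function.Surjective (biduality (R := R) E M) := by
  intro F
  obtain ⟨y, hy⟩ := hQ (F ∘ₗ LinearMap.lcomp R E N.mkQ)
  obtain ⟨x, rfl⟩ := N.mkQ_surjective y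
  have hres : Function.Surjective (LinearMap.lcomp R E N.subtype) := fun g => by
    obtain ⟨h, hh⟩ := hE.out N.subtype N.injective_subtype g
    exact ⟨h, by ext z; exact hh z⟩
  have hker : LinearMap.ker (LinearMap.lcomp R E N.subtype) ≤
      LinearMap.ker (F - biduality E M x) := by
    intro f hf
    obtain ⟨g, rfl⟩ := (mem_quotientDual (N := N)).2 fun z hz => LinearMap.congr_fun hf ⟨z, hz⟩
    have := LinearMap.congr_fun hy g
    simp only [LinearMap.mem_ker, LinearMap.sub_apply, sub_eq_zero]
    exact this.symm
  let G : MatlisDual (R := R) E (MatlisDual (R := R) E N) :=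
    ((LinearMap.ker (LinearMap.lcomp R E N.subtype)).liftQ _ hker) ∘ₗ
      ((LinearMap.lcomp R E N.subtype).quotKerEquivOfSurjective hres).symm.toLinearMap
  have hG : ∀ f : MatlisDual (R := R) E M, G (f ∘ₗ N.subtype) = F f - f x := by
    intro f
    have : ((LinearMap.lcomp R E N.subtype).quotKerEquivOfSurjective hres).symm
        (f ∘ₗ N.subtype) = Submodule.Quotient.mk f := by
      rw [LinearEquiv.symm_apply_eq]
      rfl
    simp only [G, LinearMap.comp_apply, LinearEquiv.coe_coe, this, Submodule.liftQ_apply]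
    simp
  obtain ⟨z, hz⟩ := hN G
  refine ⟨x + z, LinearMap.ext fun f => ?_⟩
  have := hG f
  rw [← hz] at this
  simp only [biduality_apply, LinearMap.comp_apply, Submodule.subtype_apply] at this
  simp [this]

theorem biduality_surjective_pi {ι : Type} [Finite ι]
    (hM : Function.Surjective (biduality (R := R) E M)) :
    Function.Surjective (biduality (R := R) E (ι → M)) := by
  classical
  have := Fintype.ofFinite ι
  intro F
  choose x hx using fun j : ι => hM (F ∘ₗ LinearMap.lcomp R E (LinearMap.proj j))
  refine ⟨x, LinearMap.ext fun f => ?_⟩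
  have hf : f = ∑ j, (f ∘ₗ LinearMap.single R (fun _ : ι => M) j) ∘ₗ LinearMap.proj j := by
    ext j y
    rw [LinearMap.comp_apply, LinearMap.comp_apply, LinearMap.sum_apply, Finset.sum_eq_single j]
    · simp
    · intro l _ hl
      simp [Pi.single_eq_of_ne hl]
    · simp
  have hj : ∀ j, F ((f ∘ₗ LinearMap.single R (fun _ : ι => M) j) ∘ₗ LinearMap.proj j) =
      f (Pi.single j (x j)) := fun j =>
    (LinearMap.congr_fun (hx j) (f ∘ₗ LinearMap.single R (fun _ : ι => M) j)).symm
  conv_rhs => rw [hf, map_sum]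
  rw [biduality_apply]
  simp_rw [hj]
  rw [← map_sum, Finset.univ_sum_single]

/-- Finitely many homomorphisms to a cogenerator separate the points of an Artinian module. -/
theorem SeparatesPoints.exists_finset (hs : SeparatesPoints R E) (M : Type u) [AddCommGroup M]
    [Module R M] [IsArtinian R M] :
    ∃ s : Finset (M →ₗ[R] E), ∀ x : M, (∀ f ∈ s, f x = 0) → x = 0 := by
  classical
  -- A minimal finite intersection of kernels must be zero, since one more functional would shrink
  -- it.
  obtain ⟨_, ⟨s, rfl⟩, hmin⟩ := IsArtinian.set_has_minimal
    (Set.range fun s : Finset (M →ₗ[R] E) => ⨅ f ∈ s, LinearMap.ker f) (Set.range_nonempty _)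
  refine ⟨s, fun x hx => ?_⟩
  by_contra h0
  obtain ⟨g, hg⟩ := hs M x h0
  refine hmin _ ⟨insert g s, rfl⟩ (SetLike.lt_iff_le_and_exists.2
    ⟨biInf_mono fun f hf => Finset.mem_insert_of_mem hf, x, ?_, fun hx' => hg ?_⟩)
  · simpa using hx
  · simp only [Finset.mem_insert, Submodule.mem_iInf, LinearMap.mem_ker] at hx'
    exact hx' g (Or.inl rfl)

end Duality

/-! ### Matlis duality over a complete Noetherian local ring -/

section Matlis

variable {R : Type u} [CommRing R] [IsLocalRing R] {E : Type u} [AddCommGroup E] [Module R E]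

open IsLocalRing

theorem smul_residueField_eq_zero {r : R} (hr : r ∈ maximalIdeal R) (x : ResidueField R) :
    r • x = 0 := by
  rw [Algebra.smul_def, ResidueField.algebraMap_eq, (residue_eq_zero_iff r).2 hr, zero_mul]

/-- The annihilator of `x ≠ 0` lies in the maximal ideal, so `Rx` maps onto the residue field, which
embeds in `E`; injectivity extends this map to `M`. -/
theorem IsInjectiveHull.separatesPoints (hE : IsInjectiveHull R (ResidueField R) E) :
    SeparatesPoints R E := by
  obtain ⟨hinj, ι, hι, -⟩ := hE
  intro M _ _ x hx
  have hker : LinearMap.ker (LinearMap.toSpanSingleton R M x) ≤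
      LinearMap.ker (Algebra.linearMap R (ResidueField R)) := by
    intro r hr
    rw [LinearMap.mem_ker, Algebra.linearMap_apply, ResidueField.algebraMap_eq,
      residue_eq_zero_iff, mem_maximalIdeal, mem_nonunits_iff]
    intro hu
    exact hx (hu.smul_eq_zero.1 (by simpa using hr))
  obtain ⟨h, hh⟩ := hinj.out
    ((LinearMap.ker (LinearMap.toSpanSingleton R M x)).liftQ
      (LinearMap.toSpanSingleton R M x) le_rfl)
    (LinearMap.ker_eq_bot.1 (Submodule.ker_liftQ_eq_bot _ _ _ le_rfl))
    (ι ∘ₗ (LinearMap.ker (LinearMap.toSpanSingleton R M x)).liftQ _ hker)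
  refine ⟨h, fun h0 => ?_⟩
  have h1 := hh (Submodule.Quotient.mk 1)
  simp only [Submodule.liftQ_apply, LinearMap.toSpanSingleton_apply, one_smul, h0,
    LinearMap.comp_apply, Algebra.linearMap_apply, map_one] at h1
  exact one_ne_zero (hι (h1.symm.trans (map_zero ι).symm))

/-- A nonzero submodule of an essential extension of the residue field contains the residue
field. -/
theorem range_le_of_essential {ι : ResidueField R →ₗ[R] E}
    (hess : ∀ N : Submodule R E, N ≠ ⊥ → LinearMap.range ι ⊓ N ≠ ⊥)
    {N : Submodule R E} (hN : N ≠ ⊥) : LinearMap.range ι ≤ N := by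
  obtain ⟨y, ⟨⟨a, rfl⟩, hy⟩, hy0⟩ := (Submodule.ne_bot_iff _).1 (hess N hN)
  have ha : a ≠ 0 := fun h => hy0 (by rw [h, map_zero])
  rintro _ ⟨b, rfl⟩
  obtain ⟨r, hr⟩ := residue_surjective (b * a⁻¹)
  have : b = r • a := by
    rw [Algebra.smul_def, ResidueField.algebraMap_eq, hr, mul_assoc, inv_mul_cancel₀ ha, mul_one]
  rw [this, map_smul]
  exact N.smul_mem r hy

/-- The socle of an essential extension of the residue field is the residue field. -/
theorem mem_range_of_smul_eq_zero {ι : ResidueField R →ₗ[R] E}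
    (hess : ∀ N : Submodule R E, N ≠ ⊥ → LinearMap.range ι ⊓ N ≠ ⊥)
    {x : E} (hx : ∀ r ∈ maximalIdeal R, r • x = 0) : x ∈ LinearMap.range ι := by
  by_cases h0 : x = 0
  · rw [h0]; exact Submodule.zero_mem _
  obtain ⟨y, ⟨hy, hyx⟩, hy0⟩ :=
    (Submodule.ne_bot_iff _).1 (hess (R ∙ x) (by simpa using h0))
  obtain ⟨r, rfl⟩ := Submodule.mem_span_singleton.1 hyx
  have hr : IsUnit r := by
    by_contra h
    exact hy0 (hx r h)
  obtain ⟨u, rfl⟩ := hr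
  have := (LinearMap.range ι).smul_mem (↑u⁻¹ : R) hy
  rwa [smul_smul, Units.inv_mul, one_smul] at this

/-- Every element of the injective hull of the residue field is killed by a power of the maximal
ideal. -/
theorem IsInjectiveHull.exists_pow_smul_eq_zero [IsNoetherianRing R]
    (hE : IsInjectiveHull R (ResidueField R) E) (x : E) :
    ∃ n : ℕ, ∀ r ∈ maximalIdeal R ^ n, r • x = 0 := by
  obtain ⟨-, ι, hι, hess⟩ := hE
  by_contra! hx
  -- If no power kills `x`, each `𝔪^n x` is nonzero and so contains the copy of the residue field,
  -- contradicting Krull's intersection theorem for `Rx`.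
  have hle : ∀ n : ℕ, LinearMap.range ι ≤
      (maximalIdeal R ^ n • (⊤ : Submodule R (R ∙ x))).map (R ∙ x).subtype := by
    intro n
    refine range_le_of_essential hess ?_
    obtain ⟨r, hr, hrx⟩ := hx n
    refine (Submodule.ne_bot_iff _).2 ⟨r • x, ?_, hrx⟩
    exact ⟨r • ⟨x, Submodule.mem_span_singleton_self x⟩,
      Submodule.smul_mem_smul hr trivial, rfl⟩
  have hkrull := (maximalIdeal R).iInf_pow_smul_eq_bot_of_isLocalRing (M := R ∙ x)
    (Ideal.IsPrime.ne_top inferInstance)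
  have hmem : ∀ n, ι 1 ∈
      (maximalIdeal R ^ n • (⊤ : Submodule R (R ∙ x))).map (R ∙ x).subtype :=
    fun n => hle n ⟨1, rfl⟩
  obtain ⟨z, -, hz⟩ := hmem 0
  have hz0 : z ∈ (⨅ n : ℕ, maximalIdeal R ^ n • (⊤ : Submodule R (R ∙ x))) := by
    rw [Submodule.mem_iInf]
    intro n
    obtain ⟨w, hw, hwz⟩ := hmem n
    rwa [← (R ∙ x).injective_subtype (hwz.trans hz.symm)]
  rw [hkrull, Submodule.mem_bot] at hz0
  rw [hz0, map_zero] at hz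
  exact one_ne_zero (hι (hz.symm.trans (map_zero ι).symm))

/-- Homomorphisms from the residue field land in the socle of `E`, so they are multiples of `ι`; `F
ι` lies in the socle too, and it determines `F`. -/
theorem IsInjectiveHull.biduality_residueField_surjective
    (hE : IsInjectiveHull R (ResidueField R) E) :
    Function.Surjective (biduality (R := R) E (ResidueField R)) := by
  obtain ⟨-, ι, hι, hess⟩ := hE
  intro F
  obtain ⟨d, hd⟩ := mem_range_of_smul_eq_zero hess (x := F ι) fun r hr => by
    rw [← map_smul, show r • ι = 0 from LinearMap.ext fun y => by
      rw [LinearMap.smul_apply, ← map_smul, smul_residueField_eq_zero hr, map_zero,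
        LinearMap.zero_apply], map_zero]
  refine ⟨d, LinearMap.ext fun f => ?_⟩
  obtain ⟨c, hc⟩ := mem_range_of_smul_eq_zero hess (x := f 1) fun r hr => by
    rw [← map_smul, smul_residueField_eq_zero hr, map_zero]
  obtain ⟨c, rfl⟩ := residue_surjective c
  have hf : f = c • ι := LinearMap.ext fun y => by
    obtain ⟨y, rfl⟩ := residue_surjective y
    have h1 : residue R y = y • 1 := by
      rw [Algebra.smul_def, ResidueField.algebraMap_eq, mul_one]
    have h2 : residue R c = c • 1 := by
      rw [Algebra.smul_def, ResidueField.algebraMap_eq, mul_one]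
    rw [h1, map_smul, ← hc, h2, LinearMap.smul_apply, map_smul, map_smul, smul_comm]
  rw [biduality_apply, hf, map_smul, ← hd, LinearMap.smul_apply]

theorem IsInjectiveHull.biduality_surjective_of_isFiniteLength
    (hE : IsInjectiveHull R (ResidueField R) E) {M : Type u} [AddCommGroup M] [Module R M]
    (hM : IsFiniteLength R M) : Function.Surjective (biduality (R := R) E M) := by
  have := hE.1
  induction hM with
  | of_subsingleton =>
    intro F
    refine ⟨0, LinearMap.ext fun f => ?_⟩
    rw [Subsingleton.elim f 0, map_zero, map_zero]
  | @of_simple_quotient M _ _ N hs _ ih =>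
    refine biduality_surjective_of_submodule_of_quotient N ih ?_
    obtain ⟨I, hI, ⟨e⟩⟩ := isSimpleModule_iff_quot_maximal.1 hs
    obtain rfl := eq_maximalIdeal hI
    exact biduality_surjective_of_surjective (M := ResidueField R) e.symm.toLinearMap
      e.symm.surjective hE.biduality_residueField_surjective

theorem isFiniteLength_quotient_maximalIdeal_pow [IsNoetherianRing R] (n : ℕ) :
    IsFiniteLength R (R ⧸ maximalIdeal R ^ (n + 1)) := by
  have hle : maximalIdeal R ^ (n + 1) ≤ maximalIdeal R := Ideal.pow_le_self n.succ_ne_zero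
  have hnt : Nontrivial (R ⧸ maximalIdeal R ^ (n + 1)) :=
    Ideal.Quotient.nontrivial_iff.2 fun h =>
      (Ideal.IsPrime.ne_top (I := maximalIdeal R) inferInstance) (top_le_iff.1 (h ▸ hle))
  have hloc : IsLocalRing (R ⧸ maximalIdeal R ^ (n + 1)) :=
    .of_surjective' (Ideal.Quotient.mk _) Ideal.Quotient.mk_surjective
  have hart : IsArtinianRing (R ⧸ maximalIdeal R ^ (n + 1)) := by
    rw [isArtinianRing_iff_isNilpotent_maximalIdeal]
    refine ⟨n + 1, ?_⟩
    have hmap : maximalIdeal (R ⧸ maximalIdeal R ^ (n + 1)) =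
        (maximalIdeal R).map (Ideal.Quotient.mk _) := by
      refine le_antisymm (fun y hy => ?_) ?_
      · obtain ⟨r, rfl⟩ := Ideal.Quotient.mk_surjective y
        refine Ideal.mem_map_of_mem _ ?_
        rw [mem_maximalIdeal, mem_nonunits_iff] at hy ⊢
        exact fun h => hy (h.map _)
      · refine le_maximalIdeal fun h => ?_
        have := (Ideal.comap_map_of_surjective (Ideal.Quotient.mk (maximalIdeal R ^ (n + 1)))
          Ideal.Quotient.mk_surjective (maximalIdeal R)).symm
        rw [h, Ideal.comap_top, ← RingHom.ker_eq_comap_bot, Ideal.mk_ker,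
          sup_eq_left.2 hle] at this
        exact (Ideal.IsPrime.ne_top (I := maximalIdeal R) inferInstance) this
    rw [hmap, ← Ideal.map_pow, Ideal.map_quotient_self, Ideal.zero_eq_bot]
  exact isFiniteLength_iff_isNoetherian_isArtinian.2 ⟨inferInstance,
    isArtinian_of_surjective_algebraMap
      (Ideal.Quotient.mk_surjective (I := maximalIdeal R ^ (n + 1)))⟩

/-- On the elements killed by a power of the maximal ideal, an endomorphism of the injective hull
is a homothety. -/
theorem IsInjectiveHull.exists_smul_eq_of_pow [IsNoetherianRing R]
    (hE : IsInjectiveHull R (ResidueField R) E) (φ : E →ₗ[R] E) (n : ℕ) :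
    ∃ r : R, ∀ x : E, (∀ s ∈ maximalIdeal R ^ n, s • x = 0) → φ x = r • x := by
  -- Elements killed by `𝔪^n` are values at 1 of maps `R/𝔪^(n+1) → E`, so `φ` gives a point of the
  -- double dual of this quotient. The exponent `n + 1` keeps the quotient nonzero.
  obtain ⟨y, hy⟩ := hE.biduality_surjective_of_isFiniteLength
    (isFiniteLength_quotient_maximalIdeal_pow (R := R) n)
    (φ ∘ₗ LinearMap.applyₗ (Submodule.Quotient.mk 1))
  obtain ⟨r, rfl⟩ := Submodule.Quotient.mk_surjective _ y
  refine ⟨r, fun x hx => ?_⟩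
  have h := LinearMap.congr_fun hy
    ((maximalIdeal R ^ (n + 1)).liftQ (LinearMap.toSpanSingleton R E x)
      fun s hs => hx s (Ideal.pow_le_pow_right n.le_succ hs))
  have h1 : φ ((1 : R) • x) = r • x := h.symm
  rwa [one_smul] at h1

/-- `F` amounts to an endomorphism of `E`, which is a homothety by some `r n` on the `𝔪^n`-torsion.
These scalars are compatible because maps `R/𝔪^m → E` separate points; completeness supplies their
limit, and `E` is the union of its torsion pieces. -/
theorem IsInjectiveHull.biduality_self_surjective [IsNoetherianRing R]
    [IsAdicComplete (maximalIdeal R) R] (hE : IsInjectiveHull R (ResidueField R) E) :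
    Function.Surjective (biduality (R := R) E R) := by
  intro F
  let φ : E →ₗ[R] E := F ∘ₗ (LinearMap.ringLmapEquivSelf R R E).symm.toLinearMap
  choose r hr using hE.exists_smul_eq_of_pow φ
  have hcomp : ∀ {m n : ℕ}, m ≤ n →
      r m ≡ r n [SMOD (maximalIdeal R ^ m • ⊤ : Submodule R R)] := by
    intro m n hmn
    rw [SModEq.sub_mem, smul_eq_mul, Ideal.mul_top]
    by_contra h
    obtain ⟨f, hf, hfx⟩ := hE.separatesPoints.exists_mem_quotientDual h
    have hf1 : ∀ s, f s = s • f 1 := fun s => by rw [← map_smul, smul_eq_mul, mul_one]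
    have hm : ∀ s ∈ maximalIdeal R ^ m, s • f 1 = 0 := fun s hs => by
      rw [← hf1]; exact mem_quotientDual.1 hf s hs
    apply hfx
    rw [hf1, sub_smul, ← hr m _ hm,
      ← hr n _ fun s hs => hm s (Ideal.pow_le_pow_right hmn hs), sub_self]
  obtain ⟨a, ha⟩ := IsPrecomplete.prec' (I := maximalIdeal R) r hcomp
  refine ⟨a, LinearMap.ext fun f => ?_⟩
  obtain ⟨n, hn⟩ := hE.exists_pow_smul_eq_zero (f 1)
  have hF : F f = φ (f 1) := by
    simp only [φ, LinearMap.comp_apply, LinearEquiv.coe_coe]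
    congr 1
    rw [LinearEquiv.eq_symm_apply]
    rfl
  have hd := ha n
  rw [SModEq.sub_mem, smul_eq_mul, Ideal.mul_top] at hd
  have h0 := hn _ hd
  rw [sub_smul, sub_eq_zero] at h0
  rw [hF, hr n _ hn, h0, biduality_apply, ← map_smul, smul_eq_mul, mul_one]

variable [IsNoetherianRing R] [IsAdicComplete (maximalIdeal R) R]

theorem IsInjectiveHull.biduality_surjective_of_finite
    (hE : IsInjectiveHull R (ResidueField R) E) (M : Type u) [AddCommGroup M] [Module R M]
    [Module.Finite R M] : Function.Surjective (biduality (R := R) E M) := by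
  have := hE.1
  obtain ⟨n, f, hf⟩ := Module.Finite.exists_fin' R M
  exact biduality_surjective_of_surjective f hf
    (biduality_surjective_pi hE.biduality_self_surjective)

theorem IsInjectiveHull.isArtinian_dual
    (hE : IsInjectiveHull R (ResidueField R) E) (M : Type u) [AddCommGroup M] [Module R M]
    [Module.Finite R M] : IsArtinian R (MatlisDual (R := R) E M) :=
  hE.separatesPoints.isArtinian_dual (hE.biduality_surjective_of_finite M)

/-- Finitely many functionals embed `B` in a power of `E`. Every functional extends to that power,
and endomorphisms of `E` are homotheties, so these functionals generate `B^∨`. -/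
theorem IsInjectiveHull.finite_dual
    (hE : IsInjectiveHull R (ResidueField R) E) (B : Type u) [AddCommGroup B] [Module R B]
    [IsArtinian R B] : Module.Finite R (MatlisDual (R := R) E B) := by
  classical
  obtain ⟨s, hs⟩ := hE.separatesPoints.exists_finset B
  refine ⟨⟨s, ?_⟩⟩
  rw [eq_top_iff]
  rintro g -
  have hinj : Function.Injective (LinearMap.pi fun f : s => (f : B →ₗ[R] E)) := by
    rw [injective_iff_map_eq_zero]
    exact fun x hx => hs x fun f hf => congrFun hx ⟨f, hf⟩
  obtain ⟨h, hh⟩ := hE.1.out _ hinj g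
  have hend : ∀ φ : E →ₗ[R] E, ∃ r : R, ∀ x, φ x = r • x := by
    intro φ
    obtain ⟨r, hr⟩ := hE.biduality_self_surjective
      (φ ∘ₗ (LinearMap.ringLmapEquivSelf R R E).toLinearMap)
    refine ⟨r, fun x => ?_⟩
    simpa using (LinearMap.congr_fun hr (LinearMap.toSpanSingleton R E x)).symm
  choose r hr using fun f : s => hend (h ∘ₗ LinearMap.single R (fun _ : s => E) f)
  have hg : g = ∑ f : s, r f • (f : B →ₗ[R] E) := by
    ext x
    rw [← hh x, ← Finset.univ_sum_single (LinearMap.pi (fun f : s => (f : B →ₗ[R] E)) x), map_sum,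
      LinearMap.sum_apply]
    exact Finset.sum_congr rfl fun f _ => hr f _
  rw [hg]
  exact Submodule.sum_mem _ fun f _ => Submodule.smul_mem _ _ (Submodule.subset_span f.2)

theorem IsInjectiveHull.biduality_bijective_of_isArtinian
    (hE : IsInjectiveHull R (ResidueField R) E) (B : Type u) [AddCommGroup B] [Module R B]
    [IsArtinian R B] : Function.Bijective (biduality (R := R) E B) := by
  have := hE.finite_dual B
  refine ⟨hE.separatesPoints.biduality_injective, ?_⟩
  -- Only the zero functional vanishes at every point of `B`; since annihilators lose no information
  -- over the finitely generated `B^∨`, the image of evaluation is everything.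
  have hbot : annihilated (LinearMap.range (biduality (R := R) E B)) = ⊥ := by
    rw [eq_bot_iff]
    intro f hf
    exact LinearMap.ext fun b => mem_annihilated.1 hf _ ⟨b, rfl⟩
  rw [← LinearMap.range_eq_top, ← hE.separatesPoints.quotientDual_annihilated
    (hE.biduality_surjective_of_finite _) (LinearMap.range (biduality (R := R) E B)), hbot,
    eq_top_iff]
  intro F _
  exact mem_quotientDual.2 fun f hf => by rw [(Submodule.mem_bot R).1 hf, map_zero]

end Matlis

/-! ### Interiors of submodules and their transport along injections -/

section Interior

variable {R : Type u} [CommRing R] {i : Selector R}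
  {B : Type u} [AddCommGroup B] [Module R B]

/-- The interior of a submodule, viewed in the ambient module. -/
def interiorIn (i : Selector R) {B : Type u} [AddCommGroup B] [Module R B]
    (C : Submodule R B) : Submodule R B :=
  (i C).map C.subtype

theorem interiorIn_le (C : Submodule R B) : interiorIn i C ≤ C :=
  Submodule.map_subtype_le _ _

theorem IsInteriorOnArtinian.map_of_injective [IsArtinian R B] (hi : IsInteriorOnArtinian i)
    {X : Type u} [AddCommGroup X] [Module R X] (g : X →ₗ[R] B) (hg : Function.Injective g) :
    (i X).map g = interiorIn i (LinearMap.range g) := by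
  have := isArtinian_of_injective g hg
  rw [interiorIn, ← hi.map_equiv X _ (LinearEquiv.ofInjective g hg), ← Submodule.map_comp]
  rfl

theorem IsInteriorOnArtinian.interiorIn_map (hi : IsInteriorOnArtinian i)
    {B' : Type u} [AddCommGroup B'] [Module R B'] [IsArtinian R B'] (g : B →ₗ[R] B')
    (hg : Function.Injective g) (C : Submodule R B) :
    interiorIn i (C.map g) = (interiorIn i C).map g := by
  have h := hi.map_of_injective (g ∘ₗ C.subtype) (hg.comp C.injective_subtype)
  rw [LinearMap.range_comp, Submodule.range_subtype] at h
  rw [← h, interiorIn, ← Submodule.map_comp]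

theorem IsInteriorOnArtinian.interiorIn_mono [IsArtinian R B] (hi : IsInteriorOnArtinian i)
    {C D : Submodule R B} (h : C ≤ D) : interiorIn i C ≤ interiorIn i D := by
  have h1 := hi.map_of_injective (Submodule.inclusion h) (Submodule.inclusion_injective h)
  calc interiorIn i C = ((i C).map (Submodule.inclusion h)).map D.subtype := by
        rw [← Submodule.map_comp, Submodule.subtype_comp_inclusion, interiorIn]
    _ ≤ interiorIn i D := by
        rw [h1]
        exact Submodule.map_mono (hi.mono D _)

theorem IsInteriorOnArtinian.interiorIn_idem [IsArtinian R B] (hi : IsInteriorOnArtinian i)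
    (C : Submodule R B) : interiorIn i (interiorIn i C) = interiorIn i C := by
  conv_lhs => rw [interiorIn.eq_def i C]
  rw [hi.interiorIn_map _ C.injective_subtype]
  exact congrArg _ (hi.idem C)

end Interior

/-! ### The dual closure and the core-hull correspondence -/

section DualClosure

open IsLocalRing

variable {R : Type u} [CommRing R] [IsLocalRing R] [IsNoetherianRing R]
  [IsAdicComplete (maximalIdeal R) R] {E : Type u} [AddCommGroup E] [Module R E] {i : Selector R}

/-- The closure of `L` in `M` dual to `i`: the annihilator of the interior of `(M/L)^∨ ⊆ M^∨`. -/
def dualClosure (E : Type u) [AddCommGroup E] [Module R E] (i : Selector R) :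
    ClosureAssignment R :=
  fun _ _ _ L => annihilated (interiorIn i (quotientDual E L))

/-- Precomposition with `q` identifies `P^∨` with `(M/ker q)^∨` inside `M^∨`, and the interior is
carried along this injection. -/
theorem dualClosure_ker (hE : IsInjectiveHull R (ResidueField R) E)
    (hi : IsInteriorOnArtinian i) {M P : Type u} [AddCommGroup M] [Module R M] [AddCommGroup P]
    [Module R P] [Module.Finite R M] (q : M →ₗ[R] P) (hq : Function.Surjective q) :
    dualClosure E i M (LinearMap.ker q) = (dualSelector E i P).comap q := by
  have := hE.isArtinian_dual M
  have hinj : Function.Injective (LinearMap.lcomp R E q) := fun f g h => by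
    ext x
    obtain ⟨y, rfl⟩ := hq x
    exact LinearMap.congr_fun h y
  have hrange : LinearMap.range (LinearMap.lcomp R E q) = quotientDual E (LinearMap.ker q) := by
    ext f
    rw [mem_quotientDual]
    constructor
    · rintro ⟨g, rfl⟩ x hx
      rw [LinearMap.lcomp_apply, LinearMap.mem_ker.1 hx, map_zero]
    · intro h
      refine ⟨(LinearMap.ker q).liftQ f h ∘ₗ (q.quotKerEquivOfSurjective hq).symm.toLinearMap, ?_⟩
      ext x
      have : (q.quotKerEquivOfSurjective hq).symm (q x) = Submodule.Quotient.mk x := by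
        rw [LinearEquiv.symm_apply_eq]
        rfl
      simp only [LinearMap.lcomp_apply, LinearMap.comp_apply, LinearEquiv.coe_coe, this]
      rfl
  ext x
  rw [dualClosure, ← hrange, ← hi.map_of_injective _ hinj, mem_annihilated, Submodule.mem_comap]
  change _ ↔ q x ∈ annihilated (i (MatlisDual (R := R) E P))
  rw [mem_annihilated]
  constructor
  · exact fun h f hf => h _ (Submodule.mem_map_of_mem hf)
  · rintro h _ ⟨f, hf, rfl⟩
    exact h f hf

theorem quotientDual_dualClosure (hE : IsInjectiveHull R (ResidueField R) E)
    {M : Type u} [AddCommGroup M] [Module R M] [Module.Finite R M] (L : Submodule R M) :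
    quotientDual E (dualClosure E i M L) = interiorIn i (quotientDual E L) :=
  hE.separatesPoints.quotientDual_annihilated (hE.biduality_surjective_of_finite M) _

theorem dualClosure_bot (hE : IsInjectiveHull R (ResidueField R) E)
    (hi : IsInteriorOnArtinian i) (M : Type u) [AddCommGroup M] [Module R M]
    [Module.Finite R M] : dualClosure E i M ⊥ = dualSelector E i M := by
  have h := dualClosure_ker hE hi (LinearMap.id : M →ₗ[R] M) Function.surjective_id
  rwa [LinearMap.ker_id, Submodule.comap_id] at h

theorem isDualClosure_dualClosure (hE : IsInjectiveHull R (ResidueField R) E)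
    (hi : IsInteriorOnArtinian i) : IsDualClosure E i (dualClosure E i) where
  le_cl M _ _ _ L := by
    conv_lhs => rw [← hE.separatesPoints.annihilated_quotientDual L]
    exact annihilated_anti (interiorIn_le _)
  idem M _ _ _ L := by
    have := hE.isArtinian_dual M
    conv_lhs => rw [dualClosure, quotientDual_dualClosure hE, hi.interiorIn_idem]
    rfl
  mono M _ _ _ L N h := by
    have := hE.isArtinian_dual M
    exact annihilated_anti (hi.interiorIn_mono (quotientDual_anti h))
  residual M P _ _ _ _ _ _ q hq := by
    rw [dualClosure_ker hE hi q hq, dualClosure_bot hE hi]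
  cl_bot M _ _ _ := dualClosure_bot hE hi M

theorem IsDualClosure.eq_dualClosure (hE : IsInjectiveHull R (ResidueField R) E)
    (hi : IsInteriorOnArtinian i) {cl : ClosureAssignment R} (hcl : IsDualClosure E i cl)
    {M : Type u} [AddCommGroup M] [Module R M] [Module.Finite R M] (L : Submodule R M) :
    cl M L = dualClosure E i M L := by
  have h := hcl.residual M (M ⧸ L) L.mkQ L.mkQ_surjective
  rw [hcl.cl_bot, ← dualClosure_ker hE hi _ L.mkQ_surjective, Submodule.ker_mkQ] at h
  exact h

theorem isReduction_quotientDual_iff (hE : IsInjectiveHull R (ResidueField R) E)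
    (hi : IsInteriorOnArtinian i) {cl : ClosureAssignment R} (hcl : IsDualClosure E i cl)
    {B : Type u} [AddCommGroup B] [Module R B] [IsArtinian R B] {A C : Submodule R B} :
    IsReduction cl (quotientDual E A) (quotientDual E C) ↔ IsExpansion i A C := by
  have := hE.finite_dual B
  have := hE.isArtinian_dual (MatlisDual (R := R) E B)
  have hs := hE.separatesPoints
  have hB := hE.biduality_bijective_of_isArtinian B
  have hle : quotientDual E C ≤ quotientDual E A ↔ A ≤ C :=
    ⟨fun h => by
      rw [← hs.annihilated_quotientDual A, ← hs.annihilated_quotientDual C]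
      exact annihilated_anti h, quotientDual_anti⟩
  -- The dual of a closure is an interior in `B^∨∨`, which evaluation identifies with the interior
  -- in `B`.
  have hint : ∀ D : Submodule R B, quotientDual E (cl _ (quotientDual E D)) =
      (interiorIn i D).map (biduality E B) := fun D => by
    rw [hcl.eq_dualClosure hE hi, quotientDual_dualClosure hE, hs.quotientDual_quotientDual hB.2,
      hi.interiorIn_map _ hB.1]
  refine and_congr hle ⟨fun h => ?_, fun h => ?_⟩
  · refine Submodule.map_injective_of_injective hB.1 ?_
    exact (hint A).symm.trans ((congrArg _ h.symm).trans (hint C))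
  · rw [← hs.annihilated_quotientDual (cl _ (quotientDual E C)), hint,
      ← hs.annihilated_quotientDual (cl _ (quotientDual E A)), hint]
    exact congrArg (fun D => annihilated (Submodule.map (biduality E B) D)) h.symm

theorem core_quotientDual (hE : IsInjectiveHull R (ResidueField R) E)
    (hi : IsInteriorOnArtinian i) {cl : ClosureAssignment R} (hcl : IsDualClosure E i cl)
    {B : Type u} [AddCommGroup B] [Module R B] [IsArtinian R B] (A : Submodule R B) :
    core cl (quotientDual E A) = quotientDual E (hull i A) := by
  have := hE.finite_dual B
  have hs := hE.separatesPoints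
  have hB := hE.biduality_bijective_of_isArtinian B
  refine le_antisymm (fun f hf => ?_) (le_sInf fun L hL => ?_)
  · have hker : hull i A ≤ LinearMap.ker f := sSup_le fun C hC x hx =>
      mem_quotientDual.1
        (Submodule.mem_sInf.1 hf _ ((isReduction_quotientDual_iff hE hi hcl).2 hC)) x hx
    exact mem_quotientDual.2 fun x hx => hker hx
  -- Every submodule of `B^∨` is dual to some submodule of `B`, so no reduction is missed by testing
  -- against expansions.
  · have hL' : quotientDual E ((quotientDual E L).comap (biduality E B)) = L := by
      refine Eq.trans ?_ (hs.annihilated_quotientDual L)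
      conv_rhs => rw [← Submodule.map_comap_eq_of_surjective hB.2 (quotientDual E L)]
      ext f
      rw [mem_quotientDual, mem_annihilated]
      constructor
      · rintro h _ ⟨x, hx, rfl⟩
        exact h x hx
      · exact fun h x hx => h _ (Submodule.mem_map_of_mem hx)
    rw [← hL']
    refine quotientDual_anti (le_sSup ?_)
    exact (isReduction_quotientDual_iff hE hi hcl).1 (by rw [hL']; exact hL)

end DualClosure

end CoreHull

theorem theorem5 (R : Type u) [CommRing R] [IsLocalRing R] [IsNoetherianRing R]
    [IsAdicComplete (IsLocalRing.maximalIdeal R) R]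
    (E : Type u) [AddCommGroup E] [Module R E]
    (hE : CoreHull.IsInjectiveHull R (IsLocalRing.ResidueField R) E)
    (i : CoreHull.Selector R) (hi : CoreHull.IsNakayamaInterior i) :
    (∃ cl : CoreHull.ClosureAssignment R, CoreHull.IsDualClosure E i cl) ∧
    ∀ cl : CoreHull.ClosureAssignment R, CoreHull.IsDualClosure E i cl →
      ∀ (B : Type u) [AddCommGroup B] [Module R B] [IsArtinian R B] (A : Submodule R B),
        Function.Bijective (CoreHull.biduality (R := R) E B) ∧
        CoreHull.quotientDual (R := R) E
            (CoreHull.core cl (CoreHull.quotientDual (R := R) E A)) =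
          (CoreHull.hull i A).map (CoreHull.biduality (R := R) E B) := by
  have hi' := hi.toIsInteriorOnArtinian
  refine ⟨⟨_, CoreHull.isDualClosure_dualClosure hE hi'⟩, fun cl hcl B _ _ _ A => ?_⟩
  have hB := hE.biduality_bijective_of_isArtinian B
  refine ⟨hB, ?_⟩
  rw [CoreHull.core_quotientDual hE hi' hcl, hE.separatesPoints.quotientDual_quotientDual hB.2]
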